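/- Let $d\ge 1$, let $\Omega\subset\mathbb{R}^d$ be a bounded open set with Lebesgue measure $m$, and let $(\cdot,\cdot)$ be the inner product of the real Hilbert space $L^2(\Omega,m)$. Let $-\Delta$ be the Dirichlet Laplacian on $\Omega$, that is, the self-adjoint operator in $L^2(\Omega,m)$ associated with the form $\mathscr{E}(u,v)=\int_\Omega Du\cdot Dv\,dm$ with domain $W^{1,2}_0(\Omega)$. Let $G=(-\Delta)^{-1}$ be its Green operator and let $\psi=G\chi_\Omega$ be the torsion function. For $0<t<(\psi,1)$ put \[ V_t=\{f\in L^2(\Omega,m):\ 0\le f\le 1\ m\text{-a.e. on }\Omega,\ (f,\psi)\le t\},\qquad J(f)=(f,Gf),\qquad \beta_t=\sup\{J(f):\ f\in V_t\}. \] Then for each $t\in(0,(\psi,1))$ the supremum $\beta_t$ is finite and there exists $f\in V_t$ such that $\beta_t=J(f)$. -/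

import Mathlib

open MeasureTheory Set
open scoped ContDiff Gradient RealInnerProductSpace

noncomputable section

namespace DirichletGreen

variable {d : ℕ}

/-- The real Hilbert space `L²(Ω, m)`, where `m` is Lebesgue measure on `Ω ⊆ ℝᵈ`. -/
abbrev L2 (Ω : Set (EuclideanSpace ℝ (Fin d))) : Type :=
  Lp ℝ 2 (volume.restrict Ω)

/-- The Hilbert space `L²(Ω, m; ℝᵈ)` of square integrable vector fields. -/
abbrev L2Vec (Ω : Set (EuclideanSpace ℝ (Fin d))) : Type :=
  Lp (EuclideanSpace ℝ (Fin d)) 2 (volume.restrict Ω)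

/-- The test functions `C_c^∞(Ω)`. -/
structure IsTestFunction (Ω : Set (EuclideanSpace ℝ (Fin d)))
    (φ : EuclideanSpace ℝ (Fin d) → ℝ) : Prop where
  contDiff : ContDiff ℝ ∞ φ
  hasCompactSupport : HasCompactSupport φ
  tsupport_subset : tsupport φ ⊆ Ω

/-- `g` is the weak (distributional) gradient of `u` on `Ω`. -/
def IsWeakGradient (Ω : Set (EuclideanSpace ℝ (Fin d))) (u : L2 Ω) (g : L2Vec Ω) : Prop :=
  ∀ φ : EuclideanSpace ℝ (Fin d) → ℝ, IsTestFunction Ω φ → ∀ i : Fin d,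
    ∫ x in Ω, u x * (∇ φ x) i = - ∫ x in Ω, g x i * φ x

/-- The pairs `(φ, ∇φ)` with `φ ∈ C_c^∞(Ω)`, inside `L²(Ω) × L²(Ω; ℝᵈ)`. The norm
`(‖u‖² + ‖g‖²)^(1/2)` of this product is the `W^{1,2}` norm on pairs `(u, Du)`. -/
def testPairs (Ω : Set (EuclideanSpace ℝ (Fin d))) :
    Submodule ℝ (WithLp 2 (L2 Ω × L2Vec Ω)) where
  carrier := {p | ∃ φ : EuclideanSpace ℝ (Fin d) → ℝ, IsTestFunction Ω φ ∧
    p.fst =ᵐ[volume.restrict Ω] φ ∧ p.snd =ᵐ[volume.restrict Ω] ∇ φ}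
  zero_mem' := by
    refine ⟨0, ⟨contDiff_const, HasCompactSupport.zero, by simp⟩, Lp.coeFn_zero _ _ _, ?_⟩
    have h : ∇ (0 : EuclideanSpace ℝ (Fin d) → ℝ) = 0 := by
      ext1 x
      simp [gradient]
    rw [h]
    exact Lp.coeFn_zero _ _ _
  add_mem' := by
    rintro p q ⟨φ, hφ, hp1, hp2⟩ ⟨η, hη, hq1, hq2⟩
    have hφd := hφ.contDiff.differentiable (by simp)
    have hηd := hη.contDiff.differentiable (by simp)
    refine ⟨φ + η, ⟨hφ.contDiff.add hη.contDiff, hφ.hasCompactSupport.add hη.hasCompactSupport,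
      (tsupport_add φ η).trans (union_subset hφ.tsupport_subset hη.tsupport_subset)⟩, ?_, ?_⟩
    · filter_upwards [Lp.coeFn_add p.fst q.fst, hp1, hq1] with x h1 h2 h3
      simp only [WithLp.add_fst, h1, Pi.add_apply, h2, h3]
    · filter_upwards [Lp.coeFn_add p.snd q.snd, hp2, hq2] with x h1 h2 h3
      simp only [WithLp.add_snd, h1, Pi.add_apply, h2, h3]
      simp [gradient, fderiv_add (hφd x) (hηd x)]
  smul_mem' := by
    rintro c p ⟨φ, hφ, hp1, hp2⟩
    have hφd := hφ.contDiff.differentiable (by simp)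
    refine ⟨c • φ, ⟨hφ.contDiff.const_smul c, hφ.hasCompactSupport.smul_left (f := fun _ => c),
      (tsupport_smul_subset_right (fun _ => c) φ).trans hφ.tsupport_subset⟩, ?_, ?_⟩
    · filter_upwards [Lp.coeFn_smul c p.fst, hp1] with x h1 h2
      simp only [WithLp.smul_fst, h1, Pi.smul_apply, h2]
    · filter_upwards [Lp.coeFn_smul c p.snd, hp2] with x h1 h2
      simp only [WithLp.smul_snd, h1, Pi.smul_apply, h2]
      simp [gradient, fderiv_const_smul (hφd x)]

/-- The Sobolev space `W_0^{1,2}(Ω)`, the closure of `C_c^∞(Ω)` in the `W^{1,2}` norm. A function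
`u` in it is represented by the pair `(u, Du)`, where `Du` is its weak gradient
(see `isWeakGradient_of_mem_W120`). -/
def W120 (Ω : Set (EuclideanSpace ℝ (Fin d))) : Submodule ℝ (WithLp 2 (L2 Ω × L2Vec Ω)) :=
  (testPairs Ω).topologicalClosure

/-- `u` lies in the domain of the Dirichlet Laplacian `-Δ` on `Ω` and `-Δ u = f`: here `-Δ` is the
operator in `L²(Ω)` associated with the form `ℰ(u, v) = (Du, Dv)` with domain `W_0^{1,2}(Ω)`. -/
def IsDirichletLaplacian (Ω : Set (EuclideanSpace ℝ (Fin d))) (u f : L2 Ω) : Prop :=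
  ∃ Du : L2Vec Ω, WithLp.toLp 2 (u, Du) ∈ W120 Ω ∧
    ∀ q ∈ W120 Ω, ⟪Du, q.snd⟫ = ⟪f, q.fst⟫

section Basic

variable {Ω : Set (EuclideanSpace ℝ (Fin d))} {φ : EuclideanSpace ℝ (Fin d) → ℝ}

theorem IsTestFunction.differentiable (h : IsTestFunction Ω φ) : Differentiable ℝ φ :=
  h.contDiff.differentiable (by simp)

theorem gradient_coord (φ : EuclideanSpace ℝ (Fin d) → ℝ) (x : EuclideanSpace ℝ (Fin d))
    (i : Fin d) : (∇ φ x) i = fderiv ℝ φ x (EuclideanSpace.single i 1) := by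
  rw [← toDual_gradient, InnerProductSpace.toDual_apply_apply,
    EuclideanSpace.inner_single_right]
  simp

theorem IsTestFunction.continuous_gradient (h : IsTestFunction Ω φ) : Continuous (∇ φ) :=
  (LinearIsometryEquiv.continuous _).comp (h.contDiff.continuous_fderiv (by simp))

theorem IsTestFunction.hasCompactSupport_gradient (h : IsTestFunction Ω φ) :
    HasCompactSupport (∇ φ) :=
  (h.hasCompactSupport.fderiv (𝕜 := ℝ)).comp_left (map_zero _)

theorem IsTestFunction.eq_zero (h : IsTestFunction Ω φ) {x} (hx : x ∉ Ω) : φ x = 0 :=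
  image_eq_zero_of_notMem_tsupport fun hh => hx (h.tsupport_subset hh)

theorem IsTestFunction.gradient_eq_zero (h : IsTestFunction Ω φ) {x} (hx : x ∉ Ω) :
    ∇ φ x = 0 := by
  have : fderiv ℝ φ x = 0 := image_eq_zero_of_notMem_tsupport
    fun hh => hx (h.tsupport_subset (tsupport_fderiv_subset ℝ hh))
  simp [gradient, this]

theorem continuous_coord (i : Fin d) :
    Continuous fun y : EuclideanSpace ℝ (Fin d) => y i := by fun_prop

theorem IsTestFunction.isWeakGradient {η : EuclideanSpace ℝ (Fin d) → ℝ}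
    (hφ : IsTestFunction Ω φ) (hη : IsTestFunction Ω η) (i : Fin d) :
    ∫ x in Ω, φ x * (∇ η x) i = - ∫ x in Ω, (∇ φ x) i * η x := by
  rw [setIntegral_eq_integral_of_forall_compl_eq_zero (fun x hx => by simp [hφ.eq_zero hx]),
    setIntegral_eq_integral_of_forall_compl_eq_zero (fun x hx => by simp [hη.eq_zero hx])]
  have c1 := hφ.contDiff.continuous
  have c2 := hη.contDiff.continuous
  have c3 := (continuous_coord i).comp hφ.continuous_gradient
  have c4 := (continuous_coord i).comp hη.continuous_gradient
  have k1 : Integrable fun x => (∇ φ x) i * η x :=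
    (c3.mul c2).integrable_of_hasCompactSupport hη.hasCompactSupport.mul_left
  have k2 : Integrable fun x => φ x * (∇ η x) i :=
    (c1.mul c4).integrable_of_hasCompactSupport hφ.hasCompactSupport.mul_right
  have k3 : Integrable fun x => φ x * η x :=
    (c1.mul c2).integrable_of_hasCompactSupport hφ.hasCompactSupport.mul_right
  simp only [gradient_coord] at k1 k2 ⊢
  exact integral_mul_fderiv_eq_neg_fderiv_mul_of_integrable k1 k2 k3
    (fun x _ => hφ.differentiable x) (fun x _ => hη.differentiable x)

theorem continuous_integral_mul (ψ : EuclideanSpace ℝ (Fin d) → ℝ)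
    (hψ : MemLp ψ 2 (volume.restrict Ω)) :
    Continuous fun u : L2 Ω => ∫ x in Ω, u x * ψ x := by
  have : (fun u : L2 Ω => ∫ x in Ω, u x * ψ x) = fun u => ⟪hψ.toLp ψ, u⟫ := by
    ext1 u
    rw [L2.inner_def]
    refine integral_congr_ae ?_
    filter_upwards [hψ.coeFn_toLp] with x hx
    simp [hx]
  rw [this]
  fun_prop

/-- The second component of an element of `W_0^{1,2}(Ω)` is the weak gradient of the first. -/
theorem isWeakGradient_of_mem_W120 {p : WithLp 2 (L2 Ω × L2Vec Ω)} (hp : p ∈ W120 Ω) :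
    IsWeakGradient Ω p.fst p.snd := by
  intro η hη i
  have m1 : MemLp (fun x => (∇ η x) i) 2 (volume.restrict Ω) :=
    (((continuous_coord i).comp hη.continuous_gradient).memLp_of_hasCompactSupport
      (hη.hasCompactSupport_gradient.comp_left (g := fun y => y i) rfl))
  have m2 : MemLp (fun x => η x • (EuclideanSpace.single i (1 : ℝ))) 2 (volume.restrict Ω) :=
    (hη.contDiff.continuous.smul continuous_const).memLp_of_hasCompactSupport
      hη.hasCompactSupport.smul_right
  have e2 : ∀ g : L2Vec Ω, ∫ x in Ω, g x i * η x = ⟪m2.toLp _, g⟫ := by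
    intro g
    rw [L2.inner_def]
    refine integral_congr_ae ?_
    filter_upwards [m2.coeFn_toLp] with x hx
    rw [hx, real_inner_smul_left, EuclideanSpace.inner_single_left]
    simp [mul_comm]
  have hcl : IsClosed {p : WithLp 2 (L2 Ω × L2Vec Ω) |
      ∫ x in Ω, p.fst x * (∇ η x) i = - ∫ x in Ω, p.snd x i * η x} := by
    simp only [e2]
    refine isClosed_eq ?_ ?_
    · exact (continuous_integral_mul _ m1).comp (WithLp.fstL 2 ℝ (L2 Ω) (L2Vec Ω)).continuous
    · exact (continuous_const.inner (WithLp.sndL 2 ℝ (L2 Ω) (L2Vec Ω)).continuous).neg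
  refine closure_minimal ?_ hcl hp
  rintro q ⟨φ, hφ, h1, h2⟩
  change ∫ x in Ω, q.fst x * (∇ η x) i = - ∫ x in Ω, q.snd x i * η x
  have a1 : ∫ x in Ω, q.fst x * (∇ η x) i = ∫ x in Ω, φ x * (∇ η x) i :=
    integral_congr_ae (by filter_upwards [h1] with x hx; rw [hx])
  have a2 : ∫ x in Ω, q.snd x i * η x = ∫ x in Ω, (∇ φ x) i * η x :=
    integral_congr_ae (by filter_upwards [h2] with x hx; rw [hx])
  rw [a1, a2, hφ.isWeakGradient hη i]

theorem norm_sq_eq {E : Type*} [NormedAddCommGroup E] [InnerProductSpace ℝ E]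
    (u : Lp E 2 (volume.restrict Ω)) {v : EuclideanSpace ℝ (Fin d) → E}
    (h : u =ᵐ[volume.restrict Ω] v) : ‖u‖ ^ 2 = ∫ x in Ω, ‖v x‖ ^ 2 := by
  rw [← real_inner_self_eq_norm_sq, L2.inner_def]
  refine integral_congr_ae ?_
  filter_upwards [h] with x hx
  rw [real_inner_self_eq_norm_sq, hx]

/-- The Poincaré inequality for test functions. -/
theorem IsTestFunction.poincare [NeZero d] (h : IsTestFunction Ω φ) {R : ℝ}
    (hR : ∀ x ∈ Ω, ‖x‖ ≤ R) :
    ∫ x in Ω, ‖φ x‖ ^ 2 ≤ 4 * R ^ 2 * ∫ x in Ω, ‖∇ φ x‖ ^ 2 := by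
  rw [setIntegral_eq_integral_of_forall_compl_eq_zero (fun x hx => by simp [h.eq_zero hx]),
    setIntegral_eq_integral_of_forall_compl_eq_zero
      (fun x hx => by simp [h.gradient_eq_zero hx])]
  have c1 := h.contDiff.continuous
  have c2 := h.continuous_gradient
  have c3 : Continuous fun x => (∇ φ x) 0 := (continuous_coord 0).comp c2
  have i1 : Integrable fun x => ‖φ x‖ ^ 2 := by
    refine Continuous.integrable_of_hasCompactSupport (c1.norm.pow 2) ?_
    refine h.hasCompactSupport.mono fun x hx h0 => hx ?_
    change ‖φ x‖ ^ 2 = 0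
    rw [h0, norm_zero, sq, mul_zero]
  have i2 : Integrable fun x => ‖∇ φ x‖ ^ 2 := by
    refine (c2.norm.pow 2).integrable_of_hasCompactSupport ?_
    refine h.hasCompactSupport_gradient.mono fun x hx h0 => hx ?_
    change ‖∇ φ x‖ ^ 2 = 0
    rw [h0, norm_zero, sq, mul_zero]
  have i3 : Integrable fun x => φ x * (2 * ((∇ φ x) 0 * x 0)) :=
    (c1.mul (continuous_const.mul (c3.mul (continuous_coord 0)))).integrable_of_hasCompactSupport
      h.hasCompactSupport.mul_right
  have i4 : Integrable fun x => φ x * φ x * x 0 :=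
    ((c1.mul c1).mul (continuous_coord 0)).integrable_of_hasCompactSupport
      (h.hasCompactSupport.mul_right.mul_right)
  have dsq : ∀ x, fderiv ℝ (fun y => φ y * φ y) x (EuclideanSpace.single 0 1)
      = 2 * (φ x * (∇ φ x) 0) := by
    intro x
    rw [fderiv_fun_mul (h.differentiable x) (h.differentiable x), gradient_coord]
    simp
    ring
  have dco : ∀ x, fderiv ℝ (fun y : EuclideanSpace ℝ (Fin d) => y 0) x
      (EuclideanSpace.single 0 1) = 1 := by
    intro x
    have : HasFDerivAt (fun y : EuclideanSpace ℝ (Fin d) => y 0)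
        (EuclideanSpace.proj (0 : Fin d) : EuclideanSpace ℝ (Fin d) →L[ℝ] ℝ) x :=
      (EuclideanSpace.proj (0 : Fin d) : EuclideanSpace ℝ (Fin d) →L[ℝ] ℝ).hasFDerivAt
    rw [this.fderiv]
    simp
  have ibp := integral_mul_fderiv_eq_neg_fderiv_mul_of_integrable
    (μ := (volume : Measure (EuclideanSpace ℝ (Fin d)))) (𝕜 := ℝ)
    (f := fun y => φ y * φ y) (g := fun y : EuclideanSpace ℝ (Fin d) => y 0)
    (v := EuclideanSpace.single 0 1)
    (by simp only [dsq]; exact i3.congr (.of_forall fun x => by ring_nf))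
    (by simp only [dco, mul_one]; exact i1.congr (.of_forall fun x => by simp [sq]))
    i4 (fun x _ => (h.differentiable.mul h.differentiable) x)
    (fun x _ => (EuclideanSpace.proj (0 : Fin d) :
      EuclideanSpace ℝ (Fin d) →L[ℝ] ℝ).differentiableAt)
  simp only [dsq, dco, mul_one] at ibp
  rw [← integral_neg] at ibp
  have e1 : ∫ x, ‖φ x‖ ^ 2 = ∫ x, φ x * φ x := by
    congr 1; ext x; simp [sq]
  have key : ∫ x, φ x * φ x ≤ ∫ x, ((1 / 2) * ‖φ x‖ ^ 2 + 2 * R ^ 2 * ‖∇ φ x‖ ^ 2) := by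
    rw [ibp]
    refine integral_mono (i3.neg.congr (.of_forall fun x => ?_))
      ((i1.const_mul _).add (i2.const_mul _)) fun x => ?_
    · simp only [Pi.neg_apply]; ring
    · by_cases hx : x ∈ Ω
      · have b1 : |(∇ φ x) 0| ≤ ‖∇ φ x‖ := PiLp.norm_apply_le (∇ φ x) 0
        have b2 : |x 0| ≤ R := (PiLp.norm_apply_le x 0).trans (hR x hx)
        have b3 : |(∇ φ x) 0 * x 0| ≤ ‖∇ φ x‖ * R := by
          rw [abs_mul]
          exact mul_le_mul b1 b2 (abs_nonneg _) (norm_nonneg _)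
        have b4 : ((∇ φ x) 0 * x 0) ^ 2 ≤ (‖∇ φ x‖ * R) ^ 2 := by
          rw [← sq_abs]
          exact pow_le_pow_left₀ (abs_nonneg _) b3 2
        have b5 : ‖φ x‖ ^ 2 = φ x ^ 2 := by simp
        simp only [b5]
        nlinarith [sq_nonneg (φ x + 2 * ((∇ φ x) 0 * x 0))]
      · simp [h.eq_zero hx, h.gradient_eq_zero hx]
  rw [integral_add (i1.const_mul _) (i2.const_mul _), integral_const_mul, integral_const_mul,
    ← e1] at key
  linarith

/-- The Poincaré inequality on `W_0^{1,2}(Ω)`, for bounded `Ω`. -/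
theorem poincare [NeZero d] (hΩ : Bornology.IsBounded Ω) :
    ∃ C : ℝ, 0 < C ∧ ∀ p ∈ W120 Ω, ‖p.fst‖ ^ 2 ≤ C * ‖p.snd‖ ^ 2 := by
  obtain ⟨R, hR0, hR⟩ := hΩ.exists_pos_norm_le
  refine ⟨4 * R ^ 2, by positivity, fun p hp => ?_⟩
  have hcl : IsClosed {p : WithLp 2 (L2 Ω × L2Vec Ω) |
      ‖p.fst‖ ^ 2 ≤ 4 * R ^ 2 * ‖p.snd‖ ^ 2} :=
    isClosed_le ((WithLp.fstL 2 ℝ (L2 Ω) (L2Vec Ω)).continuous.norm.pow 2)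
      (continuous_const.mul ((WithLp.sndL 2 ℝ (L2 Ω) (L2Vec Ω)).continuous.norm.pow 2))
  refine closure_minimal ?_ hcl hp
  rintro q ⟨φ, hφ, h1, h2⟩
  change ‖q.fst‖ ^ 2 ≤ 4 * R ^ 2 * ‖q.snd‖ ^ 2
  rw [norm_sq_eq _ h1, norm_sq_eq _ h2]
  exact hφ.poincare hR

/-- On a bounded set the Dirichlet Laplacian is a bijection from its domain onto `L²(Ω)`. -/
theorem existsUnique_isDirichletLaplacian [NeZero d] (hΩ : Bornology.IsBounded Ω) (f : L2 Ω) :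
    ∃! u : L2 Ω, IsDirichletLaplacian Ω u f := by
  obtain ⟨C, hC, hP⟩ := poincare hΩ
  have : CompleteSpace (W120 Ω) :=
    (Submodule.isClosed_topologicalClosure (testPairs Ω)).completeSpace_coe
  let S : W120 Ω →L[ℝ] L2Vec Ω := (WithLp.sndL 2 ℝ (L2 Ω) (L2Vec Ω)).comp (W120 Ω).subtypeL
  let F : W120 Ω →L[ℝ] L2 Ω := (WithLp.fstL 2 ℝ (L2 Ω) (L2Vec Ω)).comp (W120 Ω).subtypeL
  let B : W120 Ω →L[ℝ] W120 Ω →L[ℝ] ℝ := (innerSL ℝ).bilinearComp S S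
  have hB : ∀ v w : W120 Ω, B v w = ⟪v.1.snd, w.1.snd⟫ := fun v w => rfl
  have hco : IsCoercive B := by
    refine ⟨(C + 1)⁻¹, by positivity, fun v => ?_⟩
    rw [hB, real_inner_self_eq_norm_sq, mul_assoc, inv_mul_le_iff₀ (by positivity), ← sq]
    have h1 := hP v.1 v.2
    have h2 := WithLp.prod_norm_sq_eq_of_L2 v.1
    rw [Submodule.coe_norm, h2]
    linarith
  let ℓ : StrongDual ℝ (W120 Ω) := (innerSL ℝ f).comp F
  let z : W120 Ω := (InnerProductSpace.toDual ℝ (W120 Ω)).symm ℓ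
  let v : W120 Ω := hco.continuousLinearEquivOfBilin.symm z
  have hv : ∀ w : W120 Ω, ⟪v.1.snd, w.1.snd⟫ = ⟪f, w.1.fst⟫ := by
    intro w
    rw [← hB, ← hco.continuousLinearEquivOfBilin_apply]
    simp only [v, z, ContinuousLinearEquiv.apply_symm_apply,
      InnerProductSpace.toDual_symm_apply]
    rfl
  refine ⟨v.1.fst, ⟨v.1.snd, v.2, fun q hq => hv ⟨q, hq⟩⟩, ?_⟩
  rintro u ⟨Du, hu, hu'⟩
  have hmem := (W120 Ω).sub_mem hu v.2
  have h0 : ⟪Du - v.1.snd, Du - v.1.snd⟫ = (0 : ℝ) := by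
    have a := hu' _ hmem
    have b := hv ⟨_, hmem⟩
    rw [inner_sub_left]
    change ⟪Du, Du - v.1.snd⟫ = _ at a
    change ⟪v.1.snd, Du - v.1.snd⟫ = _ at b
    rw [a, b, sub_self]
  have h1 := hP _ hmem
  change ‖u - v.1.fst‖ ^ 2 ≤ C * ‖Du - v.1.snd‖ ^ 2 at h1
  rw [← real_inner_self_eq_norm_sq (Du - v.1.snd), h0, mul_zero] at h1
  have h2 : ‖u - v.1.fst‖ = 0 := by
    have := sq_nonneg ‖u - v.1.fst‖
    exact pow_eq_zero_iff (two_ne_zero) |>.1 (le_antisymm h1 this)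
  exact sub_eq_zero.1 (norm_eq_zero.1 h2)

theorem IsDirichletLaplacian.add {u f v g : L2 Ω} (h : IsDirichletLaplacian Ω u f)
    (k : IsDirichletLaplacian Ω v g) : IsDirichletLaplacian Ω (u + v) (f + g) := by
  obtain ⟨Du, hu, hu'⟩ := h
  obtain ⟨Dv, hv, hv'⟩ := k
  refine ⟨Du + Dv, (W120 Ω).add_mem hu hv, fun q hq => ?_⟩
  rw [inner_add_left, inner_add_left, hu' q hq, hv' q hq]

theorem IsDirichletLaplacian.smul {u f : L2 Ω} (c : ℝ) (h : IsDirichletLaplacian Ω u f) :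
    IsDirichletLaplacian Ω (c • u) (c • f) := by
  obtain ⟨Du, hu, hu'⟩ := h
  refine ⟨c • Du, (W120 Ω).smul_mem c hu, fun q hq => ?_⟩
  rw [real_inner_smul_left, real_inner_smul_left, hu' q hq]

end Basic

section Green

variable [NeZero d] {Ω : Set (EuclideanSpace ℝ (Fin d))}

/-- The Green operator `G = (-Δ)⁻¹` of the Dirichlet Laplacian on the bounded set `Ω`:
`G f` is the unique `u` in the domain of the Dirichlet Laplacian with `-Δ u = f`. -/
def greenOperator (hΩ : Bornology.IsBounded Ω) : L2 Ω →ₗ[ℝ] L2 Ω where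
  toFun f := (existsUnique_isDirichletLaplacian hΩ f).choose
  map_add' f g := ((existsUnique_isDirichletLaplacian hΩ (f + g)).choose_spec.2 _
    ((existsUnique_isDirichletLaplacian hΩ f).choose_spec.1.add
      (existsUnique_isDirichletLaplacian hΩ g).choose_spec.1)).symm
  map_smul' c f := ((existsUnique_isDirichletLaplacian hΩ (c • f)).choose_spec.2 _
    ((existsUnique_isDirichletLaplacian hΩ f).choose_spec.1.smul c)).symm

theorem greenOperator_eq_iff (hΩ : Bornology.IsBounded Ω) (f u : L2 Ω) :
    greenOperator hΩ f = u ↔ IsDirichletLaplacian Ω u f :=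
  ⟨fun h => h ▸ (existsUnique_isDirichletLaplacian hΩ f).choose_spec.1,
    fun h => ((existsUnique_isDirichletLaplacian hΩ f).choose_spec.2 u h).symm⟩

/-- The constant function `1 = χ_Ω` as an element of `L²(Ω)`. -/
def chi (hΩ : Bornology.IsBounded Ω) : L2 Ω :=
  indicatorConstLp 2 MeasurableSet.univ
    (by simpa using hΩ.measure_lt_top.ne) (1 : ℝ)

/-- The torsion function `ψ = G χ_Ω`. -/
def torsion (hΩ : Bornology.IsBounded Ω) : L2 Ω := greenOperator hΩ (chi hΩ)

/-- The functional `J(f) = (f, G f)`. -/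
def J (hΩ : Bornology.IsBounded Ω) (f : L2 Ω) : ℝ := ⟪f, greenOperator hΩ f⟫

/-- The admissible set `V_t = {f ∈ L²(Ω) : 0 ≤ f ≤ 1 a.e. on Ω, (f, ψ) ≤ t}`. -/
def V (hΩ : Bornology.IsBounded Ω) (t : ℝ) : Set (L2 Ω) :=
  {f | (∀ᵐ x ∂volume.restrict Ω, 0 ≤ f x ∧ f x ≤ 1) ∧ ⟪f, torsion hΩ⟫ ≤ t}

/-- The value `β_t = sup {J(f) : f ∈ V_t}` of the relaxed problem. -/
def beta (hΩ : Bornology.IsBounded Ω) (t : ℝ) : ℝ := sSup (J hΩ '' V hΩ t)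

end Green

end DirichletGreen

end

namespace DirichletGreen

open Filter Topology

/-! This is the direct method. `V` is bounded in `L²` and weakly sequentially closed, so a
maximizing sequence has a subsequence converging weakly to an admissible `x`. The Green operator is
compact, hence turns weak convergence into norm convergence, and `J` passes to the limit along the
subsequence.

Compactness rests on Rellich's theorem, `tendsto_norm_fst_zero_of_mem_W120`. A test function differs
from its translate by `y` by at most `‖y‖ ‖∇φ‖` in `L²`. Averaging over small `y` bounds `φ` by its
gradient, with a small factor, plus its integrals over balls (`IsTestFunction.integral_sq_le_ball`).
Those integrals are `L²` pairings, so they vanish in the limit of a weakly null sequence. -/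

theorem sq_integral_Icc_zero_one_le {a : ℝ → ℝ} (ha : Continuous a) :
    (∫ s in Icc (0 : ℝ) 1, a s) ^ 2 ≤ ∫ s in Icc (0 : ℝ) 1, a s ^ 2 := by
  set m := ∫ s in Icc (0 : ℝ) 1, a s with hm
  have i1 : IntegrableOn a (Icc (0 : ℝ) 1) := ha.continuousOn.integrableOn_Icc
  have i2 : IntegrableOn (fun s => a s ^ 2) (Icc (0 : ℝ) 1) :=
    (ha.pow 2).continuousOn.integrableOn_Icc
  -- The variance of `a` on the unit interval, a probability space, is nonnegative.
  have h0 : 0 ≤ ∫ s in Icc (0 : ℝ) 1, (a s ^ 2 - 2 * m * a s + m ^ 2) :=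
    by
    refine integral_nonneg fun s => ?_
    change 0 ≤ a s ^ 2 - 2 * m * a s + m ^ 2
    nlinarith [sq_nonneg (a s - m)]
  have i3 : IntegrableOn (fun s => a s ^ 2 - 2 * m * a s) (Icc (0 : ℝ) 1) :=
    i2.sub (i1.const_mul (2 * m))
  rw [integral_add i3.integrable (integrable_const _), integral_sub i2 (i1.const_mul _), integral_const_mul, ← hm] at h0
  simp at h0
  nlinarith

/-! ### Translation and ball-average estimates for test functions. -/

section Translation

variable {d : ℕ} {Ω : Set (EuclideanSpace ℝ (Fin d))} {φ : EuclideanSpace ℝ (Fin d) → ℝ}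

/-- Fundamental theorem of calculus along the segment from `x` to `x + y`, then Cauchy–Schwarz both
in the segment parameter and for the inner product. With the square inside the integral, Fubini
applies when integrating in `x`. -/
theorem IsTestFunction.sq_sub_translate_le (h : IsTestFunction Ω φ)
    (x y : EuclideanSpace ℝ (Fin d)) :
    (φ (x + y) - φ x) ^ 2 ≤ ∫ s in Icc (0 : ℝ) 1, ‖y‖ ^ 2 * ‖∇ φ (x + s • y)‖ ^ 2 := by
  have hc : Continuous fun s : ℝ => ∇ φ (x + s • y) :=
    h.continuous_gradient.comp (by fun_prop)
  have hd : ∀ s : ℝ, HasDerivAt (fun s : ℝ => φ (x + s • y)) ⟪∇ φ (x + s • y), y⟫ s := by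
    intro s
    have h1 : HasDerivAt (fun s : ℝ => x + s • y) y s := by
      simpa using ((hasDerivAt_id s).smul_const y).const_add x
    have h2 := (h.differentiable (x + s • y)).hasGradientAt.hasFDerivAt.comp_hasDerivAt s h1
    exact h2.congr_deriv (by simp)
  have hc' : Continuous fun s : ℝ => ⟪∇ φ (x + s • y), y⟫ := hc.inner continuous_const
  have e := intervalIntegral.integral_eq_sub_of_hasDerivAt (a := 0) (b := 1)
    (fun s _ => hd s) (hc'.intervalIntegrable 0 1)
  rw [intervalIntegral.integral_of_le zero_le_one, ← integral_Icc_eq_integral_Ioc] at e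
  simp only [one_smul, zero_smul, add_zero] at e
  rw [← e]
  refine (sq_integral_Icc_zero_one_le hc').trans ?_
  refine setIntegral_mono (hc'.pow 2).continuousOn.integrableOn_Icc
    (continuous_const.mul (hc.norm.pow 2)).continuousOn.integrableOn_Icc fun s => ?_
  have := abs_real_inner_le_norm (∇ φ (x + s • y)) y
  change ⟪∇ φ (x + s • y), y⟫ ^ 2 ≤ _
  rw [← sq_abs, ← mul_pow, mul_comm]
  exact pow_le_pow_left₀ (abs_nonneg _) this 2

theorem IsTestFunction.integrable_norm_sq_gradient (h : IsTestFunction Ω φ) :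
    Integrable fun x => ‖∇ φ x‖ ^ 2 := by
  refine (h.continuous_gradient.norm.pow 2).integrable_of_hasCompactSupport ?_
  refine h.hasCompactSupport_gradient.mono fun x hx h0 => hx ?_
  change ‖∇ φ x‖ ^ 2 = 0
  rw [h0, norm_zero, sq, mul_zero]

theorem IsTestFunction.integrable_mul_translate (h : IsTestFunction Ω φ)
    (y : EuclideanSpace ℝ (Fin d)) : Integrable fun x => φ x * φ (x + y) := by
  have hc := h.contDiff.continuous
  exact (hc.mul (hc.comp (by fun_prop : Continuous fun x => x + y))).integrable_of_hasCompactSupport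
    h.hasCompactSupport.mul_right

theorem IsTestFunction.integrable_sq (h : IsTestFunction Ω φ) :
    Integrable fun x => φ x ^ 2 := by
  simpa [sq] using h.integrable_mul_translate 0

/-- The translation estimate for test functions. -/
theorem IsTestFunction.integral_sq_sub_translate_le (h : IsTestFunction Ω φ)
    (y : EuclideanSpace ℝ (Fin d)) :
    ∫ x, (φ (x + y) - φ x) ^ 2 ≤ ‖y‖ ^ 2 * ∫ x, ‖∇ φ x‖ ^ 2 := by
  have hcont : Continuous (Function.uncurry fun (x : EuclideanSpace ℝ (Fin d)) (s : ℝ) =>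
      ‖y‖ ^ 2 * ‖∇ φ (x + s • y)‖ ^ 2) :=
    continuous_const.mul ((h.continuous_gradient.comp
      (by fun_prop : Continuous fun p : EuclideanSpace ℝ (Fin d) × ℝ => p.1 + p.2 • y)).norm.pow 2)
  have hi : ∀ s : ℝ, Integrable fun x => ‖y‖ ^ 2 * ‖∇ φ (x + s • y)‖ ^ 2 := fun s =>
    (h.integrable_norm_sq_gradient.comp_add_right (s • y)).const_mul _
  -- Translation invariance makes the integral independent of `s`.
  have hs : ∀ s : ℝ, ∫ x, ‖y‖ ^ 2 * ‖∇ φ (x + s • y)‖ ^ 2 = ‖y‖ ^ 2 * ∫ x, ‖∇ φ x‖ ^ 2 := by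
    intro s
    rw [integral_const_mul, integral_add_right_eq_self (fun x => ‖∇ φ x‖ ^ 2)]
  have hprod : Integrable (Function.uncurry fun (x : EuclideanSpace ℝ (Fin d)) (s : ℝ) =>
      ‖y‖ ^ 2 * ‖∇ φ (x + s • y)‖ ^ 2)
      ((volume : Measure (EuclideanSpace ℝ (Fin d))).prod (volume.restrict (Icc (0 : ℝ) 1))) := by
    rw [integrable_prod_iff' hcont.aestronglyMeasurable]
    refine ⟨.of_forall fun s => hi s, ?_⟩
    have : (fun s : ℝ => ∫ x, ‖Function.uncurry (fun (x : EuclideanSpace ℝ (Fin d)) (s : ℝ) =>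
      ‖y‖ ^ 2 * ‖∇ φ (x + s • y)‖ ^ 2) (x, s)‖) = fun _ => ‖y‖ ^ 2 * ∫ x, ‖∇ φ x‖ ^ 2 := by
      ext1 s
      rw [← hs s]
      congr 1
      ext x
      simp
    rw [this]
    exact integrable_const _
  have hint : Integrable fun x => (φ (x + y) - φ x) ^ 2 := by
    refine (((h.integrable_sq.comp_add_right y).add h.integrable_sq).sub
      ((h.integrable_mul_translate y).const_mul 2)).congr (.of_forall fun x => ?_)
    simp only [Pi.sub_apply, Pi.add_apply]
    ring
  refine (integral_mono hint hprod.integral_prod_left fun x => h.sq_sub_translate_le x y).trans ?_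
  simp only [Function.uncurry_apply_pair]
  rw [integral_integral_swap hprod]
  simp [hs]

/-- Expanding the square in the translation estimate, the two pure squares have equal integrals, so
the estimate controls how far the autocorrelation of `φ` at `y` falls below its value at `0`. -/
theorem IsTestFunction.integral_sq_le_integral_mul_translate (h : IsTestFunction Ω φ)
    (y : EuclideanSpace ℝ (Fin d)) :
    ∫ x, φ x ^ 2 ≤ ‖y‖ ^ 2 / 2 * (∫ x, ‖∇ φ x‖ ^ 2) + ∫ x, φ x * φ (x + y) := by
  have h1 := h.integral_sq_sub_translate_le y
  have e : ∫ x, (φ (x + y) - φ x) ^ 2 = 2 * ∫ x, φ x ^ 2 - φ x * φ (x + y) := by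
    have e1 : ∀ x, (φ (x + y) - φ x) ^ 2
        = (φ (x + y) ^ 2 + φ x ^ 2) - 2 * (φ x * φ (x + y)) := fun x => by ring
    simp only [e1]
    rw [integral_sub (f := fun x => φ (x + y) ^ 2 + φ x ^ 2)
      ((h.integrable_sq.comp_add_right y).add h.integrable_sq)
      ((h.integrable_mul_translate y).const_mul 2),
      integral_add (h.integrable_sq.comp_add_right y) h.integrable_sq,
      integral_add_right_eq_self (fun x => φ x ^ 2), integral_const_mul,
      integral_sub h.integrable_sq (h.integrable_mul_translate y)]
    ring
  rw [e, integral_sub h.integrable_sq (h.integrable_mul_translate y)] at h1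
  linarith

theorem setIntegral_ball_eq (φ : EuclideanSpace ℝ (Fin d) → ℝ) (x : EuclideanSpace ℝ (Fin d))
    (r : ℝ) : ∫ y in Metric.ball x r, φ y
      = ∫ y in Metric.ball (0 : EuclideanSpace ℝ (Fin d)) r, φ (x + y) := by
  rw [← integral_indicator measurableSet_ball, ← integral_indicator measurableSet_ball,
    ← integral_add_left_eq_self _ x]
  congr 1
  ext y
  simp [indicator]

/-- The indicator function of a ball as an element of `L²(Ω)`. -/
noncomputable def ballIndicator (Ω : Set (EuclideanSpace ℝ (Fin d))) (x : EuclideanSpace ℝ (Fin d)) (r : ℝ) :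
    L2 Ω :=
  indicatorConstLp 2 (measurableSet_ball (x := x) (ε := r))
    ((Measure.restrict_apply_le _ _).trans_lt measure_ball_lt_top).ne (1 : ℝ)

/-- Since `φ` vanishes off `Ω`, the part of the ball outside `Ω` does not count. Weak convergence
therefore gives pointwise convergence of ball integrals. -/
theorem IsTestFunction.inner_ballIndicator (h : IsTestFunction Ω φ) {u : L2 Ω}
    (hu : u =ᵐ[volume.restrict Ω] φ) (x : EuclideanSpace ℝ (Fin d)) (r : ℝ) :
    ⟪ballIndicator Ω x r, u⟫ = ∫ y in Metric.ball x r, φ y := by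
  rw [ballIndicator, L2.inner_indicatorConstLp_one,
    integral_congr_ae (ae_restrict_of_ae hu), Measure.restrict_restrict measurableSet_ball]
  refine (setIntegral_eq_of_subset_of_forall_sdiff_eq_zero measurableSet_ball
    inter_subset_left fun y hy => h.eq_zero fun hy' => hy.2 ⟨hy.1, hy'⟩).symm

theorem norm_ballIndicator_sq_le (x : EuclideanSpace ℝ (Fin d)) (r : ℝ) :
    ‖ballIndicator Ω x r‖ ^ 2 ≤ volume.real (Metric.ball (0 : EuclideanSpace ℝ (Fin d)) r) := by
  rw [← real_inner_self_eq_norm_sq]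
  rw [ballIndicator, L2.real_inner_indicatorConstLp_one_indicatorConstLp_one, inter_self,
    measureReal_restrict_apply measurableSet_ball]
  refine (measureReal_mono inter_subset_left measure_ball_lt_top.ne).trans_eq ?_
  simp only [measureReal_def]
  rw [Measure.addHaar_ball_center]

theorem IsTestFunction.stronglyMeasurable_setIntegral_ball (h : IsTestFunction Ω φ) (r : ℝ) :
    StronglyMeasurable fun x => ∫ y in Metric.ball x r, φ y := by
  simp only [setIntegral_ball_eq φ _ r]
  exact StronglyMeasurable.integral_prod_right' (f := fun p => φ (p.1 + p.2))
    (h.contDiff.continuous.comp (by fun_prop)).stronglyMeasurable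

/-- The bound does not depend on `x`; it serves as the dominating constant in
`tendsto_norm_zero_of_isTestFunction`. -/
theorem IsTestFunction.sq_setIntegral_ball_le (h : IsTestFunction Ω φ) {u : L2 Ω}
    (hu : u =ᵐ[volume.restrict Ω] φ) (x : EuclideanSpace ℝ (Fin d)) (r : ℝ) :
    (∫ y in Metric.ball x r, φ y) ^ 2
      ≤ volume.real (Metric.ball (0 : EuclideanSpace ℝ (Fin d)) r) * ‖u‖ ^ 2 := by
  rw [← h.inner_ballIndicator hu, ← sq_abs]
  refine (pow_le_pow_left₀ (abs_nonneg _) (abs_real_inner_le_norm _ _) 2).trans ?_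
  rw [mul_pow]
  exact mul_le_mul_of_nonneg_right (norm_ballIndicator_sq_le x r) (sq_nonneg _)

theorem IsTestFunction.integrable_prod_mul_translate (h : IsTestFunction Ω φ)
    (s : Set (EuclideanSpace ℝ (Fin d))) :
    Integrable (Function.uncurry fun x y => φ x * φ (x + y))
      ((volume : Measure (EuclideanSpace ℝ (Fin d))).prod (volume.restrict s)) := by
  have hc := h.contDiff.continuous
  have hK : HasCompactSupport
      fun p : EuclideanSpace ℝ (Fin d) × EuclideanSpace ℝ (Fin d) => φ p.1 * φ p.2 := by
    refine HasCompactSupport.intro (h.hasCompactSupport.isCompact.prod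
      h.hasCompactSupport.isCompact) fun p hp => ?_
    by_cases h1 : p.1 ∈ tsupport φ
    · rw [image_eq_zero_of_notMem_tsupport fun h2 => hp ⟨h1, h2⟩, mul_zero]
    · rw [image_eq_zero_of_notMem_tsupport h1, zero_mul]
  refine Continuous.integrable_of_hasCompactSupport
    ((hc.comp continuous_fst).mul (hc.comp (continuous_fst.add continuous_snd))) ?_
  -- The shear `(x, y) ↦ (x, x + y)` pulls back the compactly supported product `φ p.1 * φ p.2`.
  exact hK.comp_homeomorph (Homeomorph.shearAddRight (EuclideanSpace ℝ (Fin d)))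

/-- A test function is controlled in `L²` by its gradient and by its integrals over small balls. -/
theorem IsTestFunction.integral_sq_le_ball (h : IsTestFunction Ω φ) {r : ℝ} (hr : 0 < r)
    (hS : IntegrableOn (fun x => (∫ y in Metric.ball x r, φ y) ^ 2) Ω) :
    ∫ x in Ω, φ x ^ 2 ≤ r ^ 2 * (∫ x in Ω, ‖∇ φ x‖ ^ 2)
      + (volume.real (Metric.ball (0 : EuclideanSpace ℝ (Fin d)) r))⁻¹ ^ 2 *
        ∫ x in Ω, (∫ y in Metric.ball x r, φ y) ^ 2 := by
  have hA : ∫ x in Ω, φ x ^ 2 = ∫ x, φ x ^ 2 :=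
    setIntegral_eq_integral_of_forall_compl_eq_zero fun x hx => by simp [h.eq_zero hx]
  have hD : ∫ x in Ω, ‖∇ φ x‖ ^ 2 = ∫ x, ‖∇ φ x‖ ^ 2 :=
    setIntegral_eq_integral_of_forall_compl_eq_zero fun x hx => by simp [h.gradient_eq_zero hx]
  have hi := h.integrable_prod_mul_translate (Metric.ball 0 r)
  set c := volume.real (Metric.ball (0 : EuclideanSpace ℝ (Fin d)) r) with hc
  have hc0 : 0 < c := ENNReal.toReal_pos (Metric.measure_ball_pos _ _ hr).ne'
    measure_ball_lt_top.ne
  have : IsFiniteMeasure (volume.restrict (Metric.ball (0 : EuclideanSpace ℝ (Fin d)) r)) :=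
    ⟨by simpa using measure_ball_lt_top⟩
  -- Integrate the autocorrelation bound over `y` in the ball of radius `r`, where `‖y‖ ≤ r`.
  have h1 : c * ∫ x, φ x ^ 2 ≤ c * (r ^ 2 / 2 * ∫ x, ‖∇ φ x‖ ^ 2)
      + ∫ y in Metric.ball (0 : EuclideanSpace ℝ (Fin d)) r, ∫ x, φ x * φ (x + y) := by
    have : ∫ y in Metric.ball (0 : EuclideanSpace ℝ (Fin d)) r, (∫ x, φ x ^ 2) ≤
        ∫ y in Metric.ball (0 : EuclideanSpace ℝ (Fin d)) r,
          (r ^ 2 / 2 * (∫ x, ‖∇ φ x‖ ^ 2) + ∫ x, φ x * φ (x + y)) := by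
      refine setIntegral_mono_on (integrable_const _)
        ((integrable_const _).add hi.integral_prod_right) measurableSet_ball fun y hy => ?_
      refine (h.integral_sq_le_integral_mul_translate y).trans ?_
      have hy' : ‖y‖ ≤ r := by simpa using (mem_ball_zero_iff.1 hy).le
      gcongr
    rw [integral_add (integrable_const _)
      (g := fun y => ∫ x, φ x * φ (x + y)) hi.integral_prod_right] at this
    simpa using this
  have h2 : ∫ y in Metric.ball (0 : EuclideanSpace ℝ (Fin d)) r, ∫ x, φ x * φ (x + y)
      = ∫ x in Ω, φ x * ∫ y in Metric.ball x r, φ y := by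
    rw [setIntegral_eq_integral_of_forall_compl_eq_zero (s := Ω)
        fun x hx => by simp [h.eq_zero hx],
      ← integral_integral_swap hi]
    simp only [integral_const_mul, setIntegral_ball_eq φ _ r]
  have hi' : IntegrableOn (fun x => φ x * ∫ y in Metric.ball x r, φ y) Ω := by
    refine (hi.integral_prod_left.congr (.of_forall fun x => ?_)).integrableOn
    simp only [Function.uncurry_apply_pair, integral_const_mul, setIntegral_ball_eq φ _ r]
  -- Young's inequality with weight `c`: the term `c / 2 * φ x ^ 2` is absorbed into half of the
  -- left side of `h1`, which is why `r ^ 2 / 2` becomes `r ^ 2` in the end.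
  have h3 : ∫ x in Ω, φ x * ∫ y in Metric.ball x r, φ y ≤
      ∫ x in Ω, (c / 2 * φ x ^ 2 + c⁻¹ / 2 * (∫ y in Metric.ball x r, φ y) ^ 2) := by
    refine integral_mono hi' ((h.integrable_sq.integrableOn.const_mul _).add
      (hS.const_mul _)) fun x => ?_
    set S := ∫ y in Metric.ball x r, φ y
    have : 0 ≤ c / 2 * (φ x - c⁻¹ * S) ^ 2 := by positivity
    have e : c / 2 * (φ x - c⁻¹ * S) ^ 2 = c / 2 * φ x ^ 2 + c⁻¹ / 2 * S ^ 2 - φ x * S := by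
      field_simp
      ring
    change φ x * S ≤ c / 2 * φ x ^ 2 + c⁻¹ / 2 * S ^ 2
    linarith
  rw [integral_add (h.integrable_sq.integrableOn.const_mul _) (hS.const_mul _),
    integral_const_mul, integral_const_mul, hA] at h3
  rw [h2] at h1
  rw [hA, hD]
  set A := ∫ x, φ x ^ 2
  set D := ∫ x, ‖∇ φ x‖ ^ 2
  set Q := ∫ x in Ω, (∫ y in Metric.ball x r, φ y) ^ 2
  have h4 : c * A ≤ c * (r ^ 2 * D + c⁻¹ ^ 2 * Q) := by
    have : c * (c⁻¹ ^ 2 * Q) = c⁻¹ * Q := by field_simp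
    rw [mul_add, this]
    linarith
  exact le_of_mul_le_mul_left h4 hc0

end Translation
-- Weak sequential compactness and weak limits of nonnegative functions.
section WeakConvergence

/-- A bounded sequence in a separable real Hilbert space has a weakly convergent subsequence. -/
theorem exists_subseq_tendsto_inner {H : Type*} [NormedAddCommGroup H] [InnerProductSpace ℝ H]
    [CompleteSpace H] [TopologicalSpace.SeparableSpace H] {f : ℕ → H} {K : ℝ}
    (hf : ∀ n, ‖f n‖ ≤ K) :
    ∃ (x : H) (σ : ℕ → ℕ), StrictMono σ ∧
      ∀ g, Tendsto (fun n => ⟪f (σ n), g⟫) atTop (𝓝 ⟪x, g⟫) := by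
  -- The Riesz map carries the sequence into a closed ball of the dual, where the sequential
  -- Banach–Alaoglu theorem applies by separability.
  have hmem : ∀ n, StrongDual.toWeakDual (InnerProductSpace.toDual ℝ H (f n)) ∈
      WeakDual.toStrongDual ⁻¹' Metric.closedBall (0 : StrongDual ℝ H) K := fun n => by
    simpa using hf n
  obtain ⟨a, -, σ, hσ, ha⟩ := WeakDual.isSeqCompact_closedBall ℝ H 0 K hmem
  refine ⟨(InnerProductSpace.toDual ℝ H).symm (WeakDual.toStrongDual a), σ, hσ, fun g => ?_⟩
  rw [InnerProductSpace.toDual_symm_apply]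
  exact ((WeakDual.eval_continuous g).tendsto a).comp ha

/-- Testing against indicators shows that the integral of the limit over every measurable set is
nonnegative. -/
theorem ae_nonneg_of_tendsto_inner {α : Type*} [MeasurableSpace α] {μ : Measure α}
    [IsFiniteMeasure μ] {f : ℕ → Lp ℝ 2 μ} {x : Lp ℝ 2 μ} (hf : ∀ n, 0 ≤ᵐ[μ] f n)
    (h : ∀ g, Tendsto (fun n => ⟪f n, g⟫) atTop (𝓝 ⟪x, g⟫)) : 0 ≤ᵐ[μ] x := by
  refine ae_nonneg_of_forall_setIntegral_nonneg ((Lp.memLp x).integrable one_le_two)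
    fun s hs hμs => ?_
  have h' := h (indicatorConstLp 2 hs hμs.ne (1 : ℝ))
  simp only [real_inner_comm (indicatorConstLp 2 hs hμs.ne (1 : ℝ)),
    L2.inner_indicatorConstLp_one] at h'
  exact ge_of_tendsto' h' fun n => setIntegral_nonneg_of_ae (hf n)

end WeakConvergence

/-! ### Rellich compactness. -/

section Rellich

variable {d : ℕ} {Ω : Set (EuclideanSpace ℝ (Fin d))}

theorem isFiniteMeasure_restrict (hΩ : Bornology.IsBounded Ω) :
    IsFiniteMeasure (volume.restrict Ω) := ⟨by simpa using hΩ.measure_lt_top⟩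

theorem chi_ae_eq (hΩ : Bornology.IsBounded Ω) : ∀ᵐ x ∂volume.restrict Ω, chi hΩ x = 1 := by
  filter_upwards [indicatorConstLp_coeFn (p := 2) (μ := volume.restrict Ω)
    (hs := MeasurableSet.univ) (hμs := by simpa using hΩ.measure_lt_top.ne) (c := (1 : ℝ))]
    with x hx
  rw [chi, hx, indicator_of_mem (mem_univ x)]

/-- In `IsTestFunction.integral_sq_le_ball` the gradient term is small uniformly in `n` once `r` is
small; for that fixed `r` the ball term tends to zero by dominated convergence. -/
theorem tendsto_norm_zero_of_isTestFunction (hΩ : Bornology.IsBounded Ω)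
    {φ : ℕ → EuclideanSpace ℝ (Fin d) → ℝ} (hφ : ∀ n, IsTestFunction Ω (φ n))
    {u : ℕ → L2 Ω} (hu : ∀ n, u n =ᵐ[volume.restrict Ω] φ n) {K M : ℝ}
    (hK : ∀ n, ‖u n‖ ≤ K) (hM : ∀ n, ∫ x in Ω, ‖∇ (φ n) x‖ ^ 2 ≤ M)
    (hw : ∀ g, Tendsto (fun n => ⟪g, u n⟫) atTop (𝓝 0)) :
    Tendsto (fun n => ‖u n‖) atTop (𝓝 0) := by
  have := isFiniteMeasure_restrict hΩ
  have hM0 : 0 ≤ M := (integral_nonneg fun x => by positivity).trans (hM 0)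
  have hbd : ∀ (r : ℝ) (n : ℕ) (x : EuclideanSpace ℝ (Fin d)),
      ‖(∫ y in Metric.ball x r, φ n y) ^ 2‖
        ≤ volume.real (Metric.ball (0 : EuclideanSpace ℝ (Fin d)) r) * K ^ 2 := by
    intro r n x
    rw [Real.norm_of_nonneg (sq_nonneg _)]
    refine ((hφ n).sq_setIntegral_ball_le (hu n) x r).trans ?_
    have := hK n
    gcongr
  have hmeas : ∀ (r : ℝ) (n : ℕ), AEStronglyMeasurable
      (fun x => (∫ y in Metric.ball x r, φ n y) ^ 2) (volume.restrict Ω) := fun r n =>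
    (((hφ n).stronglyMeasurable_setIntegral_ball r).pow 2).aestronglyMeasurable
  have hint : ∀ (r : ℝ) (n : ℕ),
      IntegrableOn (fun x => (∫ y in Metric.ball x r, φ n y) ^ 2) Ω := fun r n =>
    Integrable.of_bound (hmeas r n) _ (.of_forall (hbd r n))
  have hlim : ∀ r : ℝ, Tendsto (fun n => ∫ x in Ω, (∫ y in Metric.ball x r, φ n y) ^ 2)
      atTop (𝓝 0) := by
    intro r
    have := tendsto_integral_of_dominated_convergence (μ := volume.restrict Ω) (f := fun _ => 0)
      (F := fun n x => (∫ y in Metric.ball x r, φ n y) ^ 2)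
      _ (hmeas r) (integrable_const _) (fun n => .of_forall (hbd r n)) (.of_forall fun x => by
        simp only [← (hφ _).inner_ballIndicator (hu _)]
        simpa using (hw (ballIndicator Ω x r)).pow 2)
    simpa using this
  have hsq : Tendsto (fun n => ‖u n‖ ^ 2) atTop (𝓝 0) := by
    refine tendsto_order.2 ⟨fun a ha => .of_forall fun n => ha.trans_le (sq_nonneg _),
      fun ε hε => ?_⟩
    obtain ⟨r, hr, hrε⟩ : ∃ r : ℝ, 0 < r ∧ r ^ 2 * M < ε / 2 := by
      -- The summand `1` keeps the quotient meaningful when `M = 0`.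
      refine ⟨√(ε / (4 * (M + 1))), by positivity, ?_⟩
      rw [Real.sq_sqrt (by positivity), div_mul_eq_mul_div, div_lt_div_iff₀ (by positivity)
        (by positivity)]
      nlinarith
    have hl := (hlim r).const_mul
      ((volume.real (Metric.ball (0 : EuclideanSpace ℝ (Fin d)) r))⁻¹ ^ 2)
    rw [mul_zero] at hl
    filter_upwards [hl.eventually_lt_const (half_pos hε)] with n hn
    rw [norm_sq_eq _ (hu n)]
    simp only [Real.norm_eq_abs, sq_abs]
    have h1 := (hφ n).integral_sq_le_ball hr (hint r n)
    have h2 := mul_le_mul_of_nonneg_left (hM n) (sq_nonneg r)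
    linarith
  simpa [Real.sqrt_sq] using hsq.sqrt

/-- Rellich's theorem: for bounded `Ω`, bounded sequences of `W_0^{1,2}(Ω)` that converge weakly to
zero in `L²(Ω)` converge strongly to zero in `L²(Ω)`. -/
theorem tendsto_norm_fst_zero_of_mem_W120 (hΩ : Bornology.IsBounded Ω)
    {p : ℕ → WithLp 2 (L2 Ω × L2Vec Ω)} (hp : ∀ n, p n ∈ W120 Ω) {M : ℝ} (hM : ∀ n, ‖p n‖ ≤ M)
    (hw : ∀ g, Tendsto (fun n => ⟪g, (p n).fst⟫) atTop (𝓝 0)) :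
    Tendsto (fun n => ‖(p n).fst‖) atTop (𝓝 0) := by
  -- Approximation by test pairs with error tending to zero preserves boundedness and the weak
  -- limit.
  have hq : ∀ n : ℕ, ∃ q ∈ testPairs Ω, ‖p n - q‖ < 1 / ((n : ℝ) + 1) := fun n => by
    simpa [dist_eq_norm] using
      Metric.mem_closure_iff.1 (hp n) (1 / ((n : ℝ) + 1)) (by positivity)
  choose q hqm hqd using hq
  choose φ hφ h1 h2 using hqm
  have hfst : ∀ z : WithLp 2 (L2 Ω × L2Vec Ω), ‖z.fst‖ ≤ ‖z‖ := fun z => by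
    refine abs_le_of_sq_le_sq' ?_ (norm_nonneg _) |>.2
    rw [WithLp.prod_norm_sq_eq_of_L2]
    linarith [sq_nonneg ‖z.snd‖]
  have hsnd : ∀ z : WithLp 2 (L2 Ω × L2Vec Ω), ‖z.snd‖ ≤ ‖z‖ := fun z => by
    refine abs_le_of_sq_le_sq' ?_ (norm_nonneg _) |>.2
    rw [WithLp.prod_norm_sq_eq_of_L2]
    linarith [sq_nonneg ‖z.fst‖]
  have hqM : ∀ n, ‖q n‖ ≤ M + 1 := fun n => by
    have h3 : 1 / ((n : ℝ) + 1) ≤ 1 := by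
      rw [div_le_one (by positivity)]
      linarith [n.cast_nonneg (α := ℝ)]
    have h4 := norm_sub_norm_le (q n) (p n)
    rw [norm_sub_rev] at h4
    linarith [hqd n, hM n]
  have hd : Tendsto (fun n => (p n).fst - (q n).fst) atTop (𝓝 0) :=
    squeeze_zero_norm (fun n => (hfst (p n - q n)).trans (hqd n).le)
      tendsto_one_div_add_atTop_nhds_zero_nat
  have hq0 : Tendsto (fun n => ‖(q n).fst‖) atTop (𝓝 0) := by
    refine tendsto_norm_zero_of_isTestFunction hΩ hφ h1 (K := M + 1) (M := (M + 1) ^ 2)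
      (fun n => (hfst _).trans (hqM n)) (fun n => ?_) fun g => ?_
    · rw [← norm_sq_eq _ (h2 n)]
      exact pow_le_pow_left₀ (norm_nonneg _) ((hsnd _).trans (hqM n)) 2
    · have := (hw g).sub ((tendsto_const_nhds (x := g)).inner hd)
      simpa [inner_sub_right] using this
  have := hd.norm.add hq0
  rw [norm_zero, add_zero] at this
  refine squeeze_zero (fun n => norm_nonneg _) (fun n => ?_) this
  simpa using norm_add_le ((p n).fst - (q n).fst) (q n).fst

end Rellich

/-! ### Compactness of the Green operator and properties of the admissible set. -/

section Green

variable {d : ℕ} [NeZero d] {Ω : Set (EuclideanSpace ℝ (Fin d))}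

theorem isDirichletLaplacian_greenOperator (hΩ : Bornology.IsBounded Ω) (f : L2 Ω) :
    IsDirichletLaplacian Ω (greenOperator hΩ f) f :=
  (greenOperator_eq_iff hΩ f _).1 rfl

/-- Testing each equation with the solution of the other gives the symmetric quantity `⟪Df, Dg⟫`. -/
theorem inner_greenOperator_left (hΩ : Bornology.IsBounded Ω) (f g : L2 Ω) :
    ⟪greenOperator hΩ f, g⟫ = ⟪f, greenOperator hΩ g⟫ := by
  obtain ⟨Df, hf, hf'⟩ := isDirichletLaplacian_greenOperator hΩ f
  obtain ⟨Dg, hg, hg'⟩ := isDirichletLaplacian_greenOperator hΩ g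
  have h1 : ⟪Df, Dg⟫ = ⟪f, greenOperator hΩ g⟫ := hf' _ hg
  have h2 : ⟪Dg, Df⟫ = ⟪g, greenOperator hΩ f⟫ := hg' _ hf
  rw [real_inner_comm, ← h2, real_inner_comm, h1]

/-- The Green operator is bounded from `L²(Ω)` to `W_0^{1,2}(Ω)`. -/
theorem exists_bound_greenOperator (hΩ : Bornology.IsBounded Ω) :
    ∃ C : ℝ, 0 ≤ C ∧ ∀ f : L2 Ω, ∃ p ∈ W120 Ω, p.fst = greenOperator hΩ f ∧
      ‖p‖ ≤ C * ‖f‖ ∧ ‖p.fst‖ ≤ C * ‖f‖ := by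
  obtain ⟨C, hC, hP⟩ := poincare hΩ
  -- With `u = G f`, the Poincaré inequality and the energy identity `‖Du‖² = (f, u)` give `‖u‖ ≤
  -- C‖f‖` and `‖Du‖² ≤ C‖f‖²`; the squares add up to `(C² + C)‖f‖²`.
  refine ⟨√(C ^ 2 + C), by positivity, fun f => ?_⟩
  obtain ⟨Du, hu, hu'⟩ := isDirichletLaplacian_greenOperator hΩ f
  have h1 := hP _ hu
  have h2 : ⟪Du, Du⟫ = ⟪f, greenOperator hΩ f⟫ := hu' _ hu
  have h4 := WithLp.prod_norm_sq_eq_of_L2 (WithLp.toLp 2 (greenOperator hΩ f, Du))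
  change ‖greenOperator hΩ f‖ ^ 2 ≤ C * ‖Du‖ ^ 2 at h1
  change _ = ‖greenOperator hΩ f‖ ^ 2 + ‖Du‖ ^ 2 at h4
  have h3 := real_inner_le_norm f (greenOperator hΩ f)
  rw [← h2, real_inner_self_eq_norm_sq] at h3
  have h5 : ‖greenOperator hΩ f‖ ≤ C * ‖f‖ := by
    by_contra! hlt
    have hpos : 0 < ‖greenOperator hΩ f‖ := (by positivity : 0 ≤ C * ‖f‖).trans_lt hlt
    nlinarith [mul_le_mul_of_nonneg_left h3 hC.le, mul_lt_mul_of_pos_right hlt hpos]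
  have h6 : ‖WithLp.toLp 2 (greenOperator hΩ f, Du)‖ ≤ √(C ^ 2 + C) * ‖f‖ := by
    refine abs_le_of_sq_le_sq' ?_ (by positivity) |>.2
    rw [mul_pow, Real.sq_sqrt (by positivity), h4]
    nlinarith [mul_le_mul_of_nonneg_left h5 (norm_nonneg f),
      pow_le_pow_left₀ (norm_nonneg _) h5 2]
  refine ⟨_, hu, rfl, h6, h5.trans ?_⟩
  refine mul_le_mul_of_nonneg_right (Real.le_sqrt_of_sq_le ?_) (norm_nonneg _)
  linarith

/-- The Green operator maps weakly convergent sequences to norm convergent ones. -/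
theorem tendsto_greenOperator_of_tendsto_inner (hΩ : Bornology.IsBounded Ω) {f : ℕ → L2 Ω}
    {x : L2 Ω} {K : ℝ} (hK : ∀ n, ‖f n‖ ≤ K)
    (h : ∀ g, Tendsto (fun n => ⟪f n, g⟫) atTop (𝓝 ⟪x, g⟫)) :
    Tendsto (fun n => greenOperator hΩ (f n)) atTop (𝓝 (greenOperator hΩ x)) := by
  obtain ⟨C, hC, hb⟩ := exists_bound_greenOperator hΩ
  choose p hp hpf hpn _ using fun n => hb (f n - x)
  have key := tendsto_norm_fst_zero_of_mem_W120 hΩ hp (M := C * (K + ‖x‖))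
    (fun n => (hpn n).trans (mul_le_mul_of_nonneg_left
      ((norm_sub_le _ _).trans (by linarith [hK n])) hC)) fun g => by
    simp only [hpf]
    -- By symmetry `G` moves onto the test vector, so `G (f n - x)` is weakly null, as Rellich's
    -- theorem requires.
    have := (h (greenOperator hΩ g)).sub_const ⟪x, greenOperator hΩ g⟫
    rw [sub_self] at this
    refine this.congr fun n => ?_
    rw [← inner_sub_left, ← inner_greenOperator_left, real_inner_comm]
  simp only [hpf, map_sub] at key
  exact tendsto_iff_norm_sub_tendsto_zero.2 key

theorem norm_le_norm_chi_of_mem_V (hΩ : Bornology.IsBounded Ω) {t : ℝ} {f : L2 Ω}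
    (hf : f ∈ V hΩ t) : ‖f‖ ≤ ‖chi hΩ‖ := by
  refine Lp.norm_le_norm_of_ae_le ?_
  filter_upwards [hf.1, chi_ae_eq hΩ] with x hx hx'
  rw [hx', norm_one, Real.norm_of_nonneg hx.1]
  exact hx.2

/-- `V_t` is weakly sequentially closed. -/
theorem mem_V_of_tendsto_inner (hΩ : Bornology.IsBounded Ω) {t : ℝ} {f : ℕ → L2 Ω} {x : L2 Ω}
    (hf : ∀ n, f n ∈ V hΩ t) (h : ∀ g, Tendsto (fun n => ⟪f n, g⟫) atTop (𝓝 ⟪x, g⟫)) :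
    x ∈ V hΩ t := by
  have := isFiniteMeasure_restrict hΩ
  refine ⟨?_, le_of_tendsto' (h _) fun n => (hf n).2⟩
  have h0 : 0 ≤ᵐ[volume.restrict Ω] x :=
    ae_nonneg_of_tendsto_inner (fun n => (hf n).1.mono fun _ hx => hx.1) h
  -- The upper bound is the positivity of `chi hΩ - f n`, which also passes to the weak limit.
  have h1 : 0 ≤ᵐ[volume.restrict Ω] (chi hΩ - x : L2 Ω) := by
    refine ae_nonneg_of_tendsto_inner (f := fun n => chi hΩ - f n) (fun n => ?_) fun g => ?_
    · filter_upwards [(hf n).1, chi_ae_eq hΩ, Lp.coeFn_sub (chi hΩ) (f n)] with y h1 h2 h3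
      rw [h3, Pi.sub_apply, h2]
      exact sub_nonneg.2 h1.2
    · simpa only [inner_sub_left] using (h g).const_sub _
  filter_upwards [h0, h1, chi_ae_eq hΩ, Lp.coeFn_sub (chi hΩ) x] with y h2 h3 h4 h5
  refine ⟨h2, ?_⟩
  rw [h5, Pi.sub_apply, h4] at h3
  simpa using h3

theorem zero_mem_V (hΩ : Bornology.IsBounded Ω) {t : ℝ} (ht : 0 ≤ t) : 0 ∈ V hΩ t := by
  refine ⟨?_, by simpa using ht⟩
  filter_upwards [Lp.coeFn_zero ℝ 2 (volume.restrict Ω)] with x hx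
  rw [hx]
  exact ⟨le_rfl, zero_le_one⟩

theorem bddAbove_J_image_V (hΩ : Bornology.IsBounded Ω) (t : ℝ) :
    BddAbove (J hΩ '' V hΩ t) := by
  obtain ⟨C, hC, hb⟩ := exists_bound_greenOperator hΩ
  refine ⟨‖chi hΩ‖ * (C * ‖chi hΩ‖), ?_⟩
  rintro _ ⟨f, hf, rfl⟩
  have hn := norm_le_norm_chi_of_mem_V hΩ hf
  obtain ⟨p, -, hp, -, hp'⟩ := hb f
  rw [hp] at hp'
  refine (real_inner_le_norm _ _).trans ?_
  exact mul_le_mul hn (hp'.trans (mul_le_mul_of_nonneg_left hn hC)) (norm_nonneg _)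
    (norm_nonneg _)

end Green

end DirichletGreen

/-! ### Existence of a maximizer. -/

theorem theorem1p1 {d : ℕ} [NeZero d] (Ω : Set (EuclideanSpace ℝ (Fin d)))
    (hΩo : IsOpen Ω) (hΩb : Bornology.IsBounded Ω) (t : ℝ) (ht0 : 0 < t)
    (ht1 : t < ⟪DirichletGreen.torsion hΩb, DirichletGreen.chi hΩb⟫) :
    BddAbove (DirichletGreen.J hΩb '' DirichletGreen.V hΩb t) ∧
      ∃ f ∈ DirichletGreen.V hΩb t, DirichletGreen.beta hΩb t = DirichletGreen.J hΩb f := by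
  have hbdd := DirichletGreen.bddAbove_J_image_V hΩb t
  refine ⟨hbdd, ?_⟩
  obtain ⟨v, -, hv, hvm⟩ := exists_seq_tendsto_sSup
    (S := DirichletGreen.J hΩb '' DirichletGreen.V hΩb t)
    ⟨_, mem_image_of_mem _ (DirichletGreen.zero_mem_V hΩb ht0.le)⟩ hbdd
  choose f hf hfv using hvm
  have hK : ∀ n, ‖f n‖ ≤ ‖DirichletGreen.chi hΩb‖ := fun n =>
    DirichletGreen.norm_le_norm_chi_of_mem_V hΩb (hf n)
  -- Finiteness of the exponent is what the separability instance for `L²` asks for.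
  have : Fact ((2 : ENNReal) ≠ ⊤) := ⟨by simp⟩
  obtain ⟨x, σ, hσ, hx⟩ := DirichletGreen.exists_subseq_tendsto_inner hK
  refine ⟨x, DirichletGreen.mem_V_of_tendsto_inner hΩb (fun n => hf (σ n)) hx, ?_⟩
  have hG := DirichletGreen.tendsto_greenOperator_of_tendsto_inner hΩb (fun n => hK (σ n)) hx
  set G := DirichletGreen.greenOperator hΩb
  have hJ : Filter.Tendsto (fun n => DirichletGreen.J hΩb (f (σ n))) Filter.atTop
      (nhds (DirichletGreen.J hΩb x)) := by
    -- Split `J (f (σ n))` into this pairing, a bounded sequence against a norm-null one, and the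
    -- pairing of `f (σ n)` with the fixed vector `G x`, which converges weakly.
    have h0 : Filter.Tendsto (fun n => ⟪f (σ n), G (f (σ n)) - G x⟫) Filter.atTop (nhds 0) := by
      have hn := (tendsto_iff_norm_sub_tendsto_zero.1 hG).const_mul ‖DirichletGreen.chi hΩb‖
      rw [mul_zero] at hn
      exact squeeze_zero_norm (fun n => (norm_inner_le_norm _ _).trans
        (mul_le_mul_of_nonneg_right (hK _) (norm_nonneg _))) hn
    have h1 := h0.add (hx (G x))
    simp only [← inner_add_right, sub_add_cancel, zero_add] at h1
    exact h1
  simp only [hfv] at hJ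
  exact tendsto_nhds_unique (hv.comp hσ.tendsto_atTop) hJ
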